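/- **Proposition 7 (Uniform estimate).** Let $\Omega\subset\mathbb{R}^n$ be open, let $c^1_f,c^2_f>0$, and let $\Phi$ be a Young function, i.e. $\Phi(u)=\int_0^u\varphi(t)\,dt$ for $u\ge 0$, where $\varphi(0)=0$, $\varphi(t)>0$ for $t>0$, $\varphi$ is nondecreasing and right continuous, $\varphi(t)\to\infty$ as $t\to\infty$, and $u\varphi(u)<a\Phi(u)$ for some $a>1$ and all $u>0$. For an open set $U\subset\Omega$ let $L_\Phi(U)$ be the space of measurable $u$ with $\int_U\Phi(|u|)\,dx<\infty$, with the Luxemburg norm $\|u\|_{\Phi,U}=\inf\{\lambda>0:\int_U\Phi(|u|/\lambda)\,dx\le 1\}$, and let $W^1_\Phi(U)$ be the closure of $C^1(\overline U)$ in the norm $\max_{|\alpha|\le 1}\|D^\alpha u\|_{\Phi,U}$. Let $\mathcal F(c^1_f,c^2_f,\Phi)$ be the class of all functionals $F$, defined for $u\in L_\Phi(\Omega)$ and $U\subset\Omega$ open with values in $[0,\infty]$, of the form $$F(u,U)=\int_U f(x,Du(x))\,dx\ \text{ if } u\in W^1_\Phi(U),\qquad F(u,U)=+\infty\ \text{ otherwise},$$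 where $f:\Omega\times\mathbb{R}^n\to\mathbb{R}$ is such that $f(x,\cdot)$ is continuous for a.e. $x$, $f(\cdot,p)$ is measurable for every $p$, $f(x,\cdot)$ is convex, and $c^1_f\Phi(|p|)\le f(x,p)\le c^2_f(1+\Phi(|p|))$ for all $x\in\Omega$, $p\in\mathbb{R}^n$. Then $\mathcal F(c^1_f,c^2_f,\Phi)$ satisfies the fundamental $L_\Phi$-estimate uniformly: for all open sets $U,U',V\subset\Omega$ with $U'\subset\subset U$ (that is, $\overline{U'}$ is compact and contained in $U$) and every $\sigma>0$ there is $M_\sigma>0$ such that for every $F\in\mathcal F(c^1_f,c^2_f,\Phi)$ and all $u,v\in L_\Phi(\Omega)$ there is a cut-off function $\phi$ between $U'$ and $U$ (that is, $\phi\in C_c^\infty(\mathbb{R}^n)$, $\operatorname{spt}\phi\subset U$, $0\le\phi\le 1$, and $\phi=1$ on $U'$) with $$F(\phi u+(1-\phi)v,\,U'\cup V)\le(1+\sigma)\big(F(u,U)+F(v,V)\big)+M_\sigma\int_{(U\cap V)\setminus U'}\Phi(|u-v|)\,dx+\sigma .$$ -/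

import Mathlib

open MeasureTheory Filter Topology Set
open scoped ENNReal

namespace OrliczFunctionals

noncomputable section

/-- `ℝⁿ` with the Euclidean norm. -/
abbrev Rn (n : ℕ) : Type := EuclideanSpace ℝ (Fin n)

/-- `Φ` (used on `[0, ∞)` only) is a Young function: `Φ(u) = ∫₀ᵘ φ(t) dt` where `φ(0) = 0`,
`φ > 0` on `(0, ∞)`, `φ` is nondecreasing, right continuous, tends to infinity, and
`u φ(u) < a Φ(u)` for some `a > 1` and all `u > 0` (so `Φ` is doubling). -/
def IsYoungFunction (Φ : ℝ → ℝ) : Prop :=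
  ∃ φ : ℝ → ℝ,
    φ 0 = 0 ∧
    (∀ t, 0 < t → 0 < φ t) ∧
    MonotoneOn φ (Ici 0) ∧
    (∀ t, 0 ≤ t → ContinuousWithinAt φ (Ici t) t) ∧
    Tendsto φ atTop atTop ∧
    (∀ u, 0 ≤ u → Φ u = ∫ t in (0 : ℝ)..u, φ t) ∧
    ∃ a : ℝ, 1 < a ∧ ∀ u, 0 < u → u * φ u < a * Φ u

/-- The modular `ρ(w, Φ, U) = ∫_U Φ(|w(x)|) dx ∈ [0, ∞]`. -/
def modular {n : ℕ} {H : Type*} [NormedAddCommGroup H] (Φ : ℝ → ℝ) (U : Set (Rn n))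
    (w : Rn n → H) : ℝ≥0∞ :=
  ∫⁻ x in U, ENNReal.ofReal (Φ ‖w x‖)

/-- Membership in `L_Φ(U)`: `w` is measurable on `U` and has finite modular. -/
def MemOrlicz {n : ℕ} {H : Type*} [NormedAddCommGroup H] (Φ : ℝ → ℝ) (U : Set (Rn n))
    (w : Rn n → H) : Prop :=
  AEStronglyMeasurable w (volume.restrict U) ∧ modular Φ U w < ∞

/-- The Luxemburg norm `inf {l > 0 : ∫_U Φ(|w(x)| / l) dx ≤ 1}`, with value `∞` if there is no
such `l`. -/
def luxNorm {n : ℕ} {H : Type*} [NormedAddCommGroup H] (Φ : ℝ → ℝ) (U : Set (Rn n))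
    (w : Rn n → H) : ℝ≥0∞ :=
  ⨅ (l : ℝ) (_ : 0 < l) (_ : ∫⁻ x in U, ENNReal.ofReal (Φ (‖w x‖ / l)) ≤ 1), ENNReal.ofReal l

/-- `w ∈ C¹(closure U)` with gradient `Dw`: `w` is differentiable in `U` with gradient `Dw`, and
both `w` and `Dw` are continuous up to the boundary of `U`. -/
def IsC1UpToBoundary {n : ℕ} (U : Set (Rn n)) (w : Rn n → ℝ) (Dw : Rn n → Rn n) : Prop :=
  ContinuousOn w (closure U) ∧ ContinuousOn Dw (closure U) ∧
    ∀ x ∈ U, HasGradientAt w (Dw x) x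

/-- `u ∈ W¹_Φ(U)` with `Du = G`. The space `W¹_Φ(U)` is the closure of `C¹(closure U)` in the
first-order Luxemburg norm, so this says that some `wⱼ ∈ C¹(closure U)` satisfy `wⱼ → u` and
`Dwⱼ → G` in `L_Φ(U)`. -/
def HasOrliczGradient {n : ℕ} (Φ : ℝ → ℝ) (U : Set (Rn n)) (u : Rn n → ℝ)
    (G : Rn n → Rn n) : Prop :=
  MemOrlicz Φ U u ∧ MemOrlicz Φ U G ∧
    ∃ (w : ℕ → Rn n → ℝ) (Dw : ℕ → Rn n → Rn n),
      (∀ j, IsC1UpToBoundary U (w j) (Dw j)) ∧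
      Tendsto (fun j => luxNorm Φ U (fun x => w j x - u x)) atTop (𝓝 0) ∧
      Tendsto (fun j => luxNorm Φ U (fun x => Dw j x - G x)) atTop (𝓝 0)

/-- `u ∈ W¹_Φ(U)`. -/
def MemOrliczSobolev {n : ℕ} (Φ : ℝ → ℝ) (U : Set (Rn n)) (u : Rn n → ℝ) : Prop :=
  ∃ G : Rn n → Rn n, HasOrliczGradient Φ U u G

/-- Admissible integrands `f : Ω × ℝⁿ → ℝ`: Carathéodory, convex in `p`, and
`c₁ Φ(|p|) ≤ f(x,p) ≤ c₂ (1 + Φ(|p|))`. -/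
structure IsIntegrand {n : ℕ} (c₁ c₂ : ℝ) (Φ : ℝ → ℝ) (Ω : Set (Rn n))
    (f : Rn n → Rn n → ℝ) : Prop where
  continuous : ∀ᵐ x ∂(volume.restrict Ω), Continuous (f x)
  measurable : ∀ p, AEMeasurable (fun x => f x p) (volume.restrict Ω)
  convex : ∀ x ∈ Ω, ConvexOn ℝ univ (f x)
  lower : ∀ x ∈ Ω, ∀ p, c₁ * Φ ‖p‖ ≤ f x p
  upper : ∀ x ∈ Ω, ∀ p, f x p ≤ c₂ * (1 + Φ ‖p‖)

/-- The class `𝓕(c₁, c₂, Φ)` of functionals `F(u, U)` with values in `[0, ∞]`, for `u ∈ L_Φ(Ω)`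
and `U ⊆ Ω` open, such that for one admissible integrand `f`
`F(u, U) = ∫_U f(x, Du(x)) dx` if `u ∈ W¹_Φ(U)`, and `F(u, U) = ∞` otherwise. -/
def functionalClass {n : ℕ} (c₁ c₂ : ℝ) (Φ : ℝ → ℝ) (Ω : Set (Rn n)) :
    Set ((Rn n → ℝ) → Set (Rn n) → ℝ≥0∞) :=
  {F | ∃ f : Rn n → Rn n → ℝ, IsIntegrand c₁ c₂ Φ Ω f ∧
    ∀ U : Set (Rn n), IsOpen U → U ⊆ Ω → ∀ u : Rn n → ℝ, MemOrlicz Φ Ω u →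
      (∀ G : Rn n → Rn n, HasOrliczGradient Φ U u G →
        F u U = ∫⁻ x in U, ENNReal.ofReal (f x (G x))) ∧
      (¬ MemOrliczSobolev Φ U u → F u U = ∞)}

/-- `U' ⊂⊂ U`. -/
def CompactlyContained {n : ℕ} (U' U : Set (Rn n)) : Prop :=
  IsCompact (closure U') ∧ closure U' ⊆ U

/-- `φ` is a cut-off function between `U'` and `U`. -/
def IsCutoff {n : ℕ} (U' U : Set (Rn n)) (φ : Rn n → ℝ) : Prop :=
  ContDiff ℝ ((⊤ : ℕ∞) : WithTop ℕ∞) φ ∧ HasCompactSupport φ ∧ tsupport φ ⊆ U ∧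
    (∀ x, 0 ≤ φ x ∧ φ x ≤ 1) ∧ ∀ x ∈ U', φ x = 1

/-- The members of the family `𝓖` satisfy the fundamental `L_Φ`-estimate on the open subsets of
`Ω`, uniformly: the constant `M` is the same for all `F ∈ 𝓖` and all `u, v ∈ L_Φ(Ω)`. -/
def UniformFundamentalEstimate {n : ℕ} (Φ : ℝ → ℝ) (Ω : Set (Rn n))
    (𝓖 : Set ((Rn n → ℝ) → Set (Rn n) → ℝ≥0∞)) : Prop :=
  ∀ U U' V : Set (Rn n), IsOpen U → IsOpen U' → IsOpen V → U ⊆ Ω → U' ⊆ Ω → V ⊆ Ω →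
    CompactlyContained U' U → ∀ σ : ℝ, 0 < σ →
      ∃ M : ℝ, 0 < M ∧ ∀ F ∈ 𝓖, ∀ u v : Rn n → ℝ, MemOrlicz Φ Ω u → MemOrlicz Φ Ω v →
        ∃ φ : Rn n → ℝ, IsCutoff U' U φ ∧
          F (fun x => φ x * u x + (1 - φ x) * v x) (U' ∪ V) ≤
            ENNReal.ofReal (1 + σ) * (F u U + F v V)
              + ENNReal.ofReal M * (∫⁻ x in (U ∩ V) \ U', ENNReal.ofReal (Φ |u x - v x|))
              + ENNReal.ofReal σ

end

end OrliczFunctionals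

namespace OrliczFunctionals

/-! ### Young functions -/

namespace IsYoungFunction

variable {Φ : ℝ → ℝ}

/-! This is De Giorgi's slicing argument. For a cut-off φ, the interpolation of u and v has gradient
Du where φ = 1 and Dv where φ = 0, so only the transition layer {0 < φ < 1} costs more than F(u,U) +
F(v,V). There the gradient is bounded by |Du| + |Dv| + |Dφ||u - v|, and the upper growth bound with
the Δ₂-condition gives an excess of at most A ∫ (1 + Φ(|Du|) + Φ(|Dv|)) plus a multiple of ∫ Φ(|u -
v|) (`lintegral_integrand_cutoff_le`).

The number A does not depend on φ. Take N cut-offs with disjoint layers in one compact set D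
(`exists_cutoff_family`); for one of them the first integral is at most 1/N of that over D
(`exists_mul_setLIntegral_le`). By the lower growth bound this is at most (|D| + (F(u,U) +
F(v,V))/c₁)/N, and a large N makes it absorbable by σ. The index depends on F, u and v, but the
finite family does not, so a bound for all its gradients yields a uniform M.

It remains to see that the interpolation is admissible on U' ∪ V, through extension by zero of φu
and (1 - φ)v (`HasOrliczGradient.mul_cutoff`). -/

theorem exists_increment_density (hΦ : IsYoungFunction Φ) :
    ∃ φ : ℝ → ℝ, (∀ t, 0 ≤ t → 0 ≤ φ t) ∧ MonotoneOn φ (Ici 0) ∧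
      (∀ s t, 0 ≤ s → 0 ≤ t → IntervalIntegrable φ volume s t) ∧
      (∀ u, 0 ≤ u → Φ u = ∫ t in (0 : ℝ)..u, φ t) ∧
      ∃ a : ℝ, 1 < a ∧ ∀ u, 0 < u → u * φ u < a * Φ u := by
  obtain ⟨φ, h0, hpos, hmono, -, -, hint, ha⟩ := hΦ
  refine ⟨φ, fun t ht => ?_, hmono, fun s t hs ht => ?_, hint, ha⟩
  · rcases ht.eq_or_lt with rfl | ht
    · exact h0.ge
    · exact (hpos t ht).le
  · refine MonotoneOn.intervalIntegrable (hmono.mono fun x hx => ?_)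
    exact (le_min hs ht).trans hx.1

theorem map_zero (hΦ : IsYoungFunction Φ) : Φ 0 = 0 := by
  obtain ⟨φ, -, -, -, h, -⟩ := hΦ.exists_increment_density
  simp [h 0 le_rfl]

theorem monotoneOn (hΦ : IsYoungFunction Φ) : MonotoneOn Φ (Ici 0) := by
  obtain ⟨φ, hn, -, hi, h, -⟩ := hΦ.exists_increment_density
  intro s hs t ht hst
  simp only [mem_Ici] at hs ht
  rw [h s hs, h t ht,
    ← intervalIntegral.integral_add_adjacent_intervals (hi 0 s le_rfl hs) (hi s t hs ht)]
  have : 0 ≤ ∫ x in s..t, φ x :=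
    intervalIntegral.integral_nonneg hst fun x hx => hn x (hs.trans hx.1)
  linarith

theorem mono (hΦ : IsYoungFunction Φ) {s t : ℝ} (hs : 0 ≤ s) (hst : s ≤ t) : Φ s ≤ Φ t :=
  hΦ.monotoneOn hs (hs.trans hst) hst

theorem nonneg (hΦ : IsYoungFunction Φ) {t : ℝ} (ht : 0 ≤ t) : 0 ≤ Φ t :=
  hΦ.map_zero ▸ hΦ.mono le_rfl ht

/-- Since the density is nondecreasing, its integral over [t, 2t] is at least that over [0, t]. -/
theorem two_mul_le (hΦ : IsYoungFunction Φ) {t : ℝ} (ht : 0 ≤ t) : 2 * Φ t ≤ Φ (2 * t) := by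
  obtain ⟨φ, hn, hm, hi, h, -⟩ := hΦ.exists_increment_density
  have h2 : 0 ≤ 2 * t := by linarith
  have key : ∫ x in (0 : ℝ)..t, φ x ≤ ∫ x in t..2 * t, φ x := by
    have e : ∫ x in t..2 * t, φ x = ∫ x in (0 : ℝ)..t, φ (x + t) := by
      rw [intervalIntegral.integral_comp_add_right]; congr 1 <;> ring
    have hi' : IntervalIntegrable (fun x => φ (x + t)) volume 0 t := by
      have := (hi t (2 * t) ht h2).comp_add_right t
      rwa [sub_self, two_mul, add_sub_cancel_right] at this
    rw [e]
    refine intervalIntegral.integral_mono_on ht (hi 0 t le_rfl ht) hi' fun x hx => ?_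
    exact hm hx.1 (add_nonneg hx.1 ht) (by linarith)
  rw [h t ht, h _ h2,
    ← intervalIntegral.integral_add_adjacent_intervals (hi 0 t le_rfl ht) (hi t (2 * t) ht h2)]
  linarith

/-- The increment Φ(rt) - Φ(t) is at most (r - 1)t φ(rt), hence at most a(r - 1)/r · Φ(rt). The
choice r = 2a/(2a - 1) makes this factor 1/2, so half of Φ(rt) can be absorbed on the left. -/
theorem exists_dilation_two (hΦ : IsYoungFunction Φ) :
    ∃ r : ℝ, 1 < r ∧ ∀ t, 0 ≤ t → Φ (r * t) ≤ 2 * Φ t := by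
  obtain ⟨φ, hn, hm, hi, h, a, ha, hlt⟩ := hΦ.exists_increment_density
  have hden : 0 < 2 * a - 1 := by linarith
  refine ⟨2 * a / (2 * a - 1), by rw [one_lt_div hden]; linarith, fun t ht => ?_⟩
  set r := 2 * a / (2 * a - 1) with hr
  have hr1 : 1 < r := by rw [hr, one_lt_div hden]; linarith
  rcases ht.eq_or_lt with rfl | ht
  · simp [hΦ.map_zero]
  have hrt : 0 < r * t := by positivity
  have htr : t ≤ r * t := by nlinarith
  have e : Φ (r * t) = Φ t + ∫ x in t..r * t, φ x := by
    rw [h t ht.le, h _ hrt.le, intervalIntegral.integral_add_adjacent_intervals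
      (hi 0 t le_rfl ht.le) (hi t _ ht.le hrt.le)]
  have b : ∫ x in t..r * t, φ x ≤ (r * t - t) * φ (r * t) := by
    have := intervalIntegral.integral_mono_on htr (hi t _ ht.le hrt.le)
      (intervalIntegrable_const (c := φ (r * t)) (μ := volume))
      fun x hx => hm (ht.le.trans hx.1) hrt.le hx.2
    simpa using this
  have c := hlt _ hrt
  have d : r * (2 * a - 1) = 2 * a := by rw [hr]; field_simp
  have e2 : (r * t - t) * φ (r * t) ≤ Φ (r * t) / 2 := by
    have h1 : 2 * a * (r - 1) = r := by linarith
    have h2 : 2 * a * ((r * t - t) * φ (r * t)) = r * t * φ (r * t) := by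
      calc _ = (2 * a * (r - 1)) * t * φ (r * t) := by ring
        _ = _ := by rw [h1]
    nlinarith
  linarith

/-- The `Δ₂`-condition, for an arbitrary dilation factor. -/
theorem exists_dilation (hΦ : IsYoungFunction Φ) {C : ℝ} (hC : 0 ≤ C) :
    ∃ K : ℝ, 0 < K ∧ ∀ t, 0 ≤ t → Φ (C * t) ≤ K * Φ t := by
  obtain ⟨r, hr, h⟩ := hΦ.exists_dilation_two
  obtain ⟨k, hk⟩ := pow_unbounded_of_one_lt C hr
  refine ⟨2 ^ k, by positivity, fun t ht => ?_⟩
  have hit : ∀ m : ℕ, Φ (r ^ m * t) ≤ 2 ^ m * Φ t := by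
    intro m
    induction m with
    | zero => simp
    | succ m ih =>
      have := h (r ^ m * t) (by positivity)
      rw [pow_succ', mul_assoc, pow_succ', mul_assoc]
      linarith
  exact (hΦ.mono (by positivity) (by gcongr)).trans (hit k)

theorem add_le (hΦ : IsYoungFunction Φ) {s t : ℝ} (hs : 0 ≤ s) (ht : 0 ≤ t) :
    Φ (s + t) ≤ Φ (2 * s) + Φ (2 * t) := by
  have h1 := hΦ.nonneg (t := 2 * s) (by positivity)
  have h2 := hΦ.nonneg (t := 2 * t) (by positivity)
  rcases le_total s t with h | h
  · have := hΦ.mono (s := s + t) (t := 2 * t) (by positivity) (by linarith)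
    linarith
  · have := hΦ.mono (s := s + t) (t := 2 * s) (by positivity) (by linarith)
    linarith

/-- A substitute for convexity: the factor 1/2 lets two modulars bounded by 1 combine into one
bounded by 1, at the price of a change of scale. -/
theorem add_le_half (hΦ : IsYoungFunction Φ) {s t : ℝ} (hs : 0 ≤ s) (ht : 0 ≤ t) :
    Φ (s + t) ≤ (Φ (4 * s) + Φ (4 * t)) / 2 := by
  have h1 := hΦ.two_mul_le (t := 2 * s) (by positivity)
  have h2 := hΦ.two_mul_le (t := 2 * t) (by positivity)
  have h3 := hΦ.add_le hs ht
  rw [← mul_assoc] at h1 h2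
  norm_num at h1 h2
  linarith

theorem exists_add_le (hΦ : IsYoungFunction Φ) :
    ∃ K : ℝ, 0 < K ∧ ∀ s t, 0 ≤ s → 0 ≤ t → Φ (s + t) ≤ K * (Φ s + Φ t) := by
  obtain ⟨K, hK, h⟩ := hΦ.exists_dilation (C := 2) (by norm_num)
  refine ⟨K, hK, fun s t hs ht => ?_⟩
  linarith [hΦ.add_le hs ht, h s hs, h t ht]

theorem aemeasurable_comp_norm (hΦ : IsYoungFunction Φ) {α H : Type*} [MeasurableSpace α]
    [NormedAddCommGroup H] {μ : Measure α} {w : α → H} (hw : AEStronglyMeasurable w μ) :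
    AEMeasurable (fun x => ENNReal.ofReal (Φ ‖w x‖)) μ := by
  -- Φ is controlled only on [0, ∞); freezing it on the negative axis gives a monotone, hence Borel,
  -- function on the line.
  have hm : Monotone fun t : ℝ => Φ (max t 0) := fun s t hst =>
    hΦ.mono (le_max_right _ _) (max_le_max_right _ hst)
  have := (hm.measurable.comp_aemeasurable hw.norm.aemeasurable).ennreal_ofReal
  simpa [Function.comp_def] using this

end IsYoungFunction

section Orlicz

variable {n : ℕ} {H H' : Type*} [NormedAddCommGroup H] [NormedAddCommGroup H'] {Φ : ℝ → ℝ}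
  {U V W : Set (Rn n)}

theorem setLIntegral_le_of_eq_zero_off {α : Type*} [MeasurableSpace α] {μ : Measure α}
    {s t : Set α} (ht : MeasurableSet t) (hs : MeasurableSet s) {f g : α → ℝ≥0∞}
    (hzero : ∀ x ∈ s, x ∉ t → f x = 0)
    (hle : ∀ x ∈ s, x ∈ t → f x ≤ g x) : ∫⁻ x in s, f x ∂μ ≤ ∫⁻ x in t, g x ∂μ := by
  have h : s ⊆ (s ∩ t) ∪ (s \ t) := fun x hx => by
    by_cases hxt : x ∈ t
    · exact .inl ⟨hx, hxt⟩
    · exact .inr ⟨hx, hxt⟩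
  calc ∫⁻ x in s, f x ∂μ ≤ ∫⁻ x in (s ∩ t) ∪ (s \ t), f x ∂μ := lintegral_mono_set h
    _ ≤ ∫⁻ x in s ∩ t, f x ∂μ + ∫⁻ x in s \ t, f x ∂μ := lintegral_union_le _ _ _
    _ = ∫⁻ x in s ∩ t, f x ∂μ := by
      rw [setLIntegral_congr_fun (g := fun _ => 0) (hs.diff ht) fun x hx => hzero x hx.1 hx.2]
      simp
    _ ≤ ∫⁻ x in s ∩ t, g x ∂μ := setLIntegral_mono' (hs.inter ht) fun x hx => hle x hx.1 hx.2
    _ ≤ _ := lintegral_mono_set inter_subset_right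

/-! ### Membership in Orlicz spaces -/

theorem MemOrlicz.of_dominated (hΦ : IsYoungFunction Φ) (hU : IsOpen U) (hW : IsOpen W)
    {u : Rn n → H} (hu : MemOrlicz Φ U u) {h : Rn n → H'} {C : ℝ} (hC : 0 ≤ C)
    (hm : AEStronglyMeasurable h (volume.restrict U))
    (hzero : ∀ x ∈ W, x ∉ U → h x = 0) (hle : ∀ x ∈ U, ‖h x‖ ≤ C * ‖u x‖) :
    MemOrlicz Φ W h := by
  refine ⟨?_, ?_⟩
  · have h1 : AEStronglyMeasurable (U.indicator h) (volume.restrict W) :=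
      ((aestronglyMeasurable_indicator_iff hU.measurableSet).2 hm).mono_measure
        Measure.restrict_le_self
    refine h1.congr ?_
    filter_upwards [ae_restrict_mem hW.measurableSet] with x hx
    by_cases hxU : x ∈ U
    · simp [hxU]
    · simp [hxU, hzero x hx hxU]
  · obtain ⟨K, hK, hd⟩ := hΦ.exists_dilation hC
    calc modular Φ W h ≤ ∫⁻ x in U, ENNReal.ofReal K * ENNReal.ofReal (Φ ‖u x‖) := by
          refine setLIntegral_le_of_eq_zero_off hU.measurableSet hW.measurableSet
            (fun x hx hxU => by simp [hzero x hx hxU, hΦ.map_zero]) fun x _ hx => ?_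
          rw [← ENNReal.ofReal_mul hK.le]
          exact ENNReal.ofReal_le_ofReal
            ((hΦ.mono (norm_nonneg _) (hle x hx)).trans (hd _ (norm_nonneg _)))
      _ = ENNReal.ofReal K * modular Φ U u := lintegral_const_mul' _ _ ENNReal.ofReal_ne_top
      _ < ∞ := ENNReal.mul_lt_top ENNReal.ofReal_lt_top hu.2

theorem MemOrlicz.add (hΦ : IsYoungFunction Φ) {u v : Rn n → H}
    (hu : MemOrlicz Φ U u) (hv : MemOrlicz Φ U v) : MemOrlicz Φ U (fun x => u x + v x) := by
  obtain ⟨K, hK, hd⟩ := hΦ.exists_add_le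
  refine ⟨hu.1.add hv.1, ?_⟩
  calc modular Φ U (fun x => u x + v x)
      ≤ ∫⁻ x in U, ENNReal.ofReal K * (ENNReal.ofReal (Φ ‖u x‖) + ENNReal.ofReal (Φ ‖v x‖)) := by
        refine lintegral_mono fun x => ?_
        rw [← ENNReal.ofReal_add (hΦ.nonneg (norm_nonneg _)) (hΦ.nonneg (norm_nonneg _)),
          ← ENNReal.ofReal_mul hK.le]
        exact ENNReal.ofReal_le_ofReal
          ((hΦ.mono (norm_nonneg _) (norm_add_le _ _)).trans (hd _ _ (norm_nonneg _) (norm_nonneg _)))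
    _ = ENNReal.ofReal K * (modular Φ U u + modular Φ U v) := by
        rw [lintegral_const_mul' _ _ ENNReal.ofReal_ne_top,
          lintegral_add_left' (hΦ.aemeasurable_comp_norm hu.1)]
        rfl
    _ < ∞ := ENNReal.mul_lt_top ENNReal.ofReal_lt_top (ENNReal.add_lt_top.2 ⟨hu.2, hv.2⟩)

/-! ### Convergence in the Luxemburg norm -/

theorem luxNorm_lt_of_modular_le {w : Rn n → H} {l : ℝ} {ε : ℝ≥0∞} (hl : 0 < l)
    (h : ∫⁻ x in U, ENNReal.ofReal (Φ (‖w x‖ / l)) ≤ 1) (hlε : ENNReal.ofReal l < ε) :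
    luxNorm Φ U w < ε :=
  lt_of_le_of_lt (iInf₂_le_of_le l hl (iInf_le _ h)) hlε

/-- Reduces norm convergence to modular bounds at every scale, so that no norm axioms for `luxNorm`
are needed below. -/
theorem tendsto_luxNorm_zero_iff (hΦ : IsYoungFunction Φ) {ι : Type*} {F : Filter ι}
    {w : ι → Rn n → H} :
    Tendsto (fun j => luxNorm Φ U (w j)) F (𝓝 0) ↔
      ∀ l : ℝ, 0 < l → ∀ᶠ j in F, ∫⁻ x in U, ENNReal.ofReal (Φ (‖w j x‖ / l)) ≤ 1 := by
  constructor
  · intro h l hl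
    filter_upwards [h.eventually_lt_const (ENNReal.ofReal_pos.2 hl)] with j hj
    simp only [luxNorm, iInf_lt_iff] at hj
    obtain ⟨m, hm, hint, hml⟩ := hj
    refine le_trans (lintegral_mono fun x => ENNReal.ofReal_le_ofReal ?_) hint
    have : m < l := (ENNReal.ofReal_lt_ofReal_iff hl).1 hml
    exact hΦ.mono (by positivity) (by gcongr)
  · intro h
    rw [ENNReal.tendsto_nhds_zero]
    intro ε hε
    obtain ⟨l, hl0, hl⟩ := ENNReal.lt_iff_exists_real_btwn.1 hε
    have hl0' : 0 < l := by simpa using hl.1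
    filter_upwards [h l hl0'] with j hj
    exact (luxNorm_lt_of_modular_le hl0' hj hl.2).le

theorem tendsto_luxNorm_zero_of_dominated (hΦ : IsYoungFunction Φ) (hU : IsOpen U)
    (hW : IsOpen W) {ι : Type*} {F : Filter ι} {w : ι → Rn n → H} {h : ι → Rn n → H'} {C : ℝ}
    (hC : 0 < C) (hw : Tendsto (fun j => luxNorm Φ U (w j)) F (𝓝 0))
    (hzero : ∀ j, ∀ x ∈ W, x ∉ U → h j x = 0) (hle : ∀ j, ∀ x ∈ U, ‖h j x‖ ≤ C * ‖w j x‖) :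
    Tendsto (fun j => luxNorm Φ W (h j)) F (𝓝 0) := by
  rw [tendsto_luxNorm_zero_iff hΦ] at hw ⊢
  intro l hl
  filter_upwards [hw (l / C) (by positivity)] with j hj
  refine le_trans (setLIntegral_le_of_eq_zero_off hU.measurableSet hW.measurableSet
    (fun x hx hxU => by simp [hzero j x hx hxU, hΦ.map_zero]) fun x _ hx => ?_) hj
  refine ENNReal.ofReal_le_ofReal (hΦ.mono (by positivity) ?_)
  rw [div_div_eq_mul_div, mul_comm]
  gcongr
  exact hle j x hx

theorem tendsto_luxNorm_zero_add (hΦ : IsYoungFunction Φ) {ι : Type*} {F : Filter ι}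
    {w z : ι → Rn n → H} (hm : ∀ j, AEStronglyMeasurable (w j) (volume.restrict U))
    (hw : Tendsto (fun j => luxNorm Φ U (w j)) F (𝓝 0))
    (hz : Tendsto (fun j => luxNorm Φ U (z j)) F (𝓝 0)) :
    Tendsto (fun j => luxNorm Φ U (fun x => w j x + z j x)) F (𝓝 0) := by
  rw [tendsto_luxNorm_zero_iff hΦ] at hw hz ⊢
  intro l hl
  filter_upwards [hw (l / 4) (by positivity), hz (l / 4) (by positivity)] with j hj hj'
  have hmeas : AEMeasurable (fun x => ENNReal.ofReal (Φ (‖w j x‖ / (l / 4))))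
      (volume.restrict U) := by
    have hm' : AEStronglyMeasurable (fun x => ‖w j x‖ / (l / 4)) (volume.restrict U) :=
      ((hm j).norm.aemeasurable.div_const _).aestronglyMeasurable
    refine (hΦ.aemeasurable_comp_norm hm').congr (.of_forall fun x => ?_)
    simp only [Real.norm_eq_abs]
    rw [abs_of_nonneg (by positivity)]
  calc ∫⁻ x in U, ENNReal.ofReal (Φ (‖w j x + z j x‖ / l))
      ≤ ∫⁻ x in U, ENNReal.ofReal (1 / 2) * (ENNReal.ofReal (Φ (‖w j x‖ / (l / 4)))
          + ENNReal.ofReal (Φ (‖z j x‖ / (l / 4)))) := by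
        refine lintegral_mono fun x => ?_
        rw [← ENNReal.ofReal_add (hΦ.nonneg (by positivity)) (hΦ.nonneg (by positivity)),
          ← ENNReal.ofReal_mul (by norm_num)]
        refine ENNReal.ofReal_le_ofReal ?_
        have h1 : ‖w j x + z j x‖ / l ≤ ‖w j x‖ / l + ‖z j x‖ / l := by
          rw [← add_div]; gcongr; exact norm_add_le _ _
        have h2 := hΦ.add_le_half (s := ‖w j x‖ / l) (t := ‖z j x‖ / l)
          (by positivity) (by positivity)
        have e1 : 4 * (‖w j x‖ / l) = ‖w j x‖ / (l / 4) := by field_simp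
        have e2 : 4 * (‖z j x‖ / l) = ‖z j x‖ / (l / 4) := by field_simp
        rw [e1, e2] at h2
        linarith [hΦ.mono (by positivity) h1]
    _ = ENNReal.ofReal (1 / 2) * ((∫⁻ x in U, ENNReal.ofReal (Φ (‖w j x‖ / (l / 4))))
          + ∫⁻ x in U, ENNReal.ofReal (Φ (‖z j x‖ / (l / 4)))) := by
        rw [lintegral_const_mul' _ _ ENNReal.ofReal_ne_top, lintegral_add_left' hmeas]
    _ ≤ ENNReal.ofReal (1 / 2) * (1 + 1) := by gcongr
    _ = 1 := by
        rw [show (1 + 1 : ℝ≥0∞) = ENNReal.ofReal 2 by norm_num,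
          ← ENNReal.ofReal_mul (by norm_num)]
        norm_num

end Orlicz

/-! ### Weak gradients of products and sums -/

section Gradient

variable {n : ℕ} {Φ : ℝ → ℝ} {U W : Set (Rn n)}

theorem hasGradientAt_add {f g : Rn n → ℝ} {f' g' x : Rn n} (hf : HasGradientAt f f' x)
    (hg : HasGradientAt g g' x) : HasGradientAt (fun y => f y + g y) (f' + g') x := by
  rw [hasGradientAt_iff_hasFDerivAt, map_add]
  exact hf.hasFDerivAt.add hg.hasFDerivAt

theorem hasGradientAt_mul {f g : Rn n → ℝ} {f' g' x : Rn n} (hf : HasGradientAt f f' x)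
    (hg : HasGradientAt g g' x) :
    HasGradientAt (fun y => f y * g y) (f x • g' + g x • f') x := by
  rw [hasGradientAt_iff_hasFDerivAt, map_add, map_smulₛₗ, map_smulₛₗ]
  exact hf.hasFDerivAt.mul hg.hasFDerivAt

theorem eq_zero_of_hasGradientAt_of_isLocalMin {f : Rn n → ℝ} {f' x : Rn n}
    (hf : HasGradientAt f f' x) (h : IsLocalMin f x) : f' = 0 := by
  simpa using h.hasFDerivAt_eq_zero hf.hasFDerivAt

theorem HasOrliczGradient.add (hΦ : IsYoungFunction Φ) (hU : IsOpen U) {u v : Rn n → ℝ}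
    {G H : Rn n → Rn n} (hu : HasOrliczGradient Φ U u G) (hv : HasOrliczGradient Φ U v H) :
    HasOrliczGradient Φ U (fun x => u x + v x) (fun x => G x + H x) := by
  obtain ⟨hu, hG, w, Dw, hw, hwu, hwG⟩ := hu
  obtain ⟨hv, hH, z, Dz, hz, hzv, hzH⟩ := hv
  refine ⟨hu.add hΦ hv, hG.add hΦ hH, fun j x => w j x + z j x, fun j x => Dw j x + Dz j x,
    fun j => ⟨(hw j).1.add (hz j).1, (hw j).2.1.add (hz j).2.1, fun x hx =>
      hasGradientAt_add ((hw j).2.2 x hx) ((hz j).2.2 x hx)⟩, ?_, ?_⟩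
  · simpa only [add_sub_add_comm, Pi.sub_apply] using tendsto_luxNorm_zero_add hΦ (fun j =>
      (((hw j).1.mono subset_closure).aestronglyMeasurable hU.measurableSet).sub hu.1) hwu hzv
  · simpa only [add_sub_add_comm, Pi.sub_apply] using tendsto_luxNorm_zero_add hΦ (fun j =>
      (((hw j).2.1.mono subset_closure).aestronglyMeasurable hU.measurableSet).sub hG.1) hwG hzH

/-- Multiplication by a bounded `C¹` function `θ ≥ 0` extends weakly differentiable functions by
zero to open sets `W` which outside of `U` meet only the interior of the zero set of `θ`. -/
theorem HasOrliczGradient.mul_cutoff (hΦ : IsYoungFunction Φ) (hU : IsOpen U) (hW : IsOpen W)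
    {u : Rn n → ℝ} {G : Rn n → Rn n} (hu : HasOrliczGradient Φ U u G) {θ : Rn n → ℝ}
    {Dθ : Rn n → Rn n} (hθ : ∀ x, HasGradientAt θ (Dθ x) x) (hDθ : Continuous Dθ) {L : ℝ}
    (hL : ∀ x, ‖Dθ x‖ ≤ L) (h0 : ∀ x, 0 ≤ θ x) (h1 : ∀ x, θ x ≤ 1)
    (hWU : W ⊆ U ∪ interior {x | θ x = 0}) :
    HasOrliczGradient Φ W (fun x => θ x * u x) (fun x => θ x • G x + u x • Dθ x) := by
  have hc : Continuous θ := continuous_iff_continuousAt.2 fun x => (hθ x).continuousAt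
  have hZ : IsClosed {x | θ x = 0} := isClosed_eq hc continuous_const
  have hDz : ∀ x, θ x = 0 → Dθ x = 0 := fun x hx =>
    eq_zero_of_hasGradientAt_of_isLocalMin (hθ x) (.of_forall fun y => hx ▸ h0 y)
  have hz : ∀ x ∈ W, x ∉ U → θ x = 0 := fun x hx hxU =>
    interior_subset (s := {x | θ x = 0}) ((hWU hx).resolve_left hxU)
  have hWc : closure W ⊆ closure U ∪ {x | θ x = 0} :=
    closure_minimal (hWU.trans (union_subset_union subset_closure interior_subset))
      (isClosed_closure.union hZ)
  -- `L` may be 0, while the domination lemma for norms divides by its constant.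
  have hL' : ∀ x, ‖Dθ x‖ ≤ L + 1 := fun x => (hL x).trans (by linarith)
  have hL0 : 0 < L + 1 := by linarith [(norm_nonneg _).trans (hL 0)]
  have hθn : ∀ x, ‖θ x‖ ≤ 1 := fun x => by rw [Real.norm_of_nonneg (h0 x)]; exact h1 x
  obtain ⟨hu, hG, w, Dw, hw, hwu, hwG⟩ := hu
  -- The approximants are uncontrolled off the closure of `U`, but the rest of the closure of `W`
  -- lies in the closed zero set of `θ`, where the products vanish; continuity glues over the two
  -- closed sets.
  have hext : ∀ {E : Type} [NormedAddCommGroup E] {h : Rn n → E},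
      ContinuousOn h (closure U) → (∀ x, θ x = 0 → h x = 0) → ContinuousOn h (closure W) := by
    intro E _ h hh hh0
    refine (hh.union_of_isClosed ?_ isClosed_closure hZ).mono hWc
    exact continuousOn_const.congr fun x hx => hh0 x hx
  have memθG : MemOrlicz Φ W (fun x => θ x • G x) :=
    hG.of_dominated hΦ hU hW zero_le_one (hc.aestronglyMeasurable.smul hG.1)
      (fun x hx hxU => by simp [hz x hx hxU])
      (fun x _ => by rw [norm_smul]; gcongr; exact hθn x)
  have memuD : MemOrlicz Φ W (fun x => u x • Dθ x) :=
    hu.of_dominated hΦ hU hW hL0.le (hu.1.smul hDθ.aestronglyMeasurable)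
      (fun x hx hxU => by simp [hDz x (hz x hx hxU)])
      (fun x _ => by rw [norm_smul, mul_comm]; gcongr; exact hL' x)
  refine ⟨?_, memθG.add hΦ memuD, fun j x => θ x * w j x,
    fun j x => θ x • Dw j x + w j x • Dθ x, fun j => ⟨?_, ?_, ?_⟩, ?_, ?_⟩
  · exact hu.of_dominated hΦ hU hW zero_le_one (hc.aestronglyMeasurable.mul hu.1)
      (fun x hx hxU => by simp [hz x hx hxU])
      (fun x _ => by rw [norm_mul]; gcongr; exact hθn x)
  · exact hext (hc.continuousOn.mul (hw j).1) fun x hx => by simp [hx]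
  · exact hext ((hc.continuousOn.smul (hw j).2.1).add ((hw j).1.smul hDθ.continuousOn))
      fun x hx => by simp [hx, hDz x hx]
  · intro x hx
    rcases hWU hx with hxU | hxZ
    · exact hasGradientAt_mul (hθ x) ((hw j).2.2 x hxU)
    · have hx0 : θ x = 0 := interior_subset (s := {x | θ x = 0}) hxZ
      simp only [hx0, hDz x hx0, zero_smul, smul_zero, add_zero]
      refine (hasGradientAt_const x (0 : ℝ)).congr_of_eventuallyEq ?_
      filter_upwards [isOpen_interior.mem_nhds hxZ] with y hy
      have : θ y = 0 := interior_subset (s := {x | θ x = 0}) hy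
      simp [this]
  · refine tendsto_luxNorm_zero_of_dominated hΦ hU hW one_pos hwu
      (fun j x hx hxU => by simp [hz x hx hxU]) fun j x _ => ?_
    rw [← mul_sub, norm_mul]
    gcongr
    exact hθn x
  · have e : ∀ j x, θ x • Dw j x + w j x • Dθ x - (θ x • G x + u x • Dθ x)
        = θ x • (Dw j x - G x) + (w j x - u x) • Dθ x := fun j x => by
      rw [smul_sub, sub_smul]; abel
    simp only [e]
    refine tendsto_luxNorm_zero_add hΦ (fun j => ?_)
      (tendsto_luxNorm_zero_of_dominated hΦ hU hW one_pos hwG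
        (fun j x hx hxU => by simp [hz x hx hxU])
        fun j x _ => by rw [norm_smul]; gcongr; exact hθn x)
      (tendsto_luxNorm_zero_of_dominated hΦ hU hW hL0 hwu
        (fun j x hx hxU => by simp [hDz x (hz x hx hxU)])
        fun j x _ => by rw [norm_smul, mul_comm]; gcongr; exact hL' x)
    have hcont : ContinuousOn (fun x => θ x • Dw j x) (closure W) :=
      hext (hc.continuousOn.smul (hw j).2.1) fun x hx => by simp [hx]
    simp only [smul_sub]
    exact ((hcont.mono subset_closure).aestronglyMeasurable hW.measurableSet).sub memθG.1

end Gradient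

/-! ### Cut-off functions -/

section Cutoff

variable {n : ℕ} {U U' V : Set (Rn n)}

theorem IsCutoff.exists_gradient {φ : Rn n → ℝ} (hφ : IsCutoff U' U φ) :
    ∃ Dφ : Rn n → Rn n, Continuous Dφ ∧ (∀ x, HasGradientAt φ (Dφ x) x) ∧
      ∃ L : ℝ, ∀ x, ‖Dφ x‖ ≤ L := by
  have hc : Continuous (fderiv ℝ φ) := hφ.1.continuous_fderiv (by simp)
  refine ⟨gradient φ, (InnerProductSpace.toDual ℝ (Rn n)).symm.continuous.comp hc, fun x =>
    ((hφ.1.differentiable (by simp)) x).hasGradientAt, ?_⟩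
  obtain ⟨L, hL⟩ := hc.bounded_above_of_compact_support (hφ.2.1.fderiv (𝕜 := ℝ))
  exact ⟨L, fun x => by simpa [gradient] using hL x⟩

/-- Arbitrarily many cut-off functions whose transition layers are pairwise disjoint and contained
in a compact set which does not depend on their number. -/
theorem exists_cutoff_family (hU : IsOpen U) (h : CompactlyContained U' U) :
    ∃ D : Set (Rn n), IsCompact D ∧ ∀ N : ℕ, ∃ φ : ℕ → Rn n → ℝ,
      (∀ i < N, IsCutoff U' U (φ i)) ∧ (∀ i x, 0 < φ i x → x ∈ D) ∧
      ∀ i j x, 0 < φ i x → φ i x < 1 → 0 < φ j x → φ j x < 1 → i = j := by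
  obtain ⟨V, hV, hUV, hVU, hVc⟩ := exists_open_between_and_isCompact_closure h.1 hU h.2
  obtain ⟨χ, hχ, hr, hs, h1⟩ := exists_contMDiff_support_eq_eq_one_iff
    (n := (⊤ : ℕ∞)) (modelWithCornersSelf ℝ (Rn n)) hV isClosed_closure hUV
  rw [contMDiff_iff_contDiff] at hχ
  have hpos : ∀ (N i : ℕ) (x : Rn n), Real.smoothTransition (N * χ x - i) ≠ 0 → x ∈ V := by
    intro N i x hx
    rw [← hs, Function.mem_support]
    intro hx0
    refine hx (Real.smoothTransition.zero_of_nonpos ?_)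
    simp [hx0]
  -- The i-th function climbs from 0 to 1 as χ runs from i/N to (i + 1)/N, so the layers are slabs
  -- between consecutive levels of χ. For i < N the climb is complete where χ = 1.
  refine ⟨closure V, hVc, fun N => ⟨fun i x => Real.smoothTransition (N * χ x - i), ?_, ?_, ?_⟩⟩
  · intro i hi
    have hts : tsupport (fun x => Real.smoothTransition (N * χ x - i)) ⊆ closure V :=
      closure_mono fun x hx => hpos N i x hx
    refine ⟨?_, hVc.of_isClosed_subset (isClosed_tsupport _) hts, hts.trans hVU,
      fun x => ⟨Real.smoothTransition.nonneg _, Real.smoothTransition.le_one _⟩, fun x hx => ?_⟩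
    · exact Real.smoothTransition.contDiff.comp ((contDiff_const.mul hχ).sub contDiff_const)
    · refine Real.smoothTransition.one_of_one_le ?_
      rw [(h1 x).1 (subset_closure hx)]
      have : (i : ℝ) + 1 ≤ N := by exact_mod_cast hi
      linarith
  · exact fun i x hx => subset_closure (hpos N i x hx.ne')
  · have hlayer : ∀ (i : ℕ) (x : Rn n), 0 < Real.smoothTransition (N * χ x - i) →
        Real.smoothTransition (N * χ x - i) < 1 → (i : ℝ) < N * χ x ∧ N * χ x < i + 1 := by
      intro i x h0 h1
      constructor
      · by_contra! hc
        exact h0.ne' (Real.smoothTransition.zero_of_nonpos (by linarith))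
      · by_contra! hc
        exact h1.ne (Real.smoothTransition.one_of_one_le (by linarith))
    intro i j x hi0 hi1 hj0 hj1
    obtain ⟨a, b⟩ := hlayer i x hi0 hi1
    obtain ⟨c, d⟩ := hlayer j x hj0 hj1
    have h1 : (i : ℝ) < j + 1 := by linarith
    have h2 : (j : ℝ) < i + 1 := by linarith
    norm_cast at h1 h2
    omega

end Cutoff

/-! ### The fundamental estimate -/

section Estimate

variable {n : ℕ} {Φ : ℝ → ℝ} {Ω U U' V : Set (Rn n)} {c₁ c₂ : ℝ} {f : Rn n → Rn n → ℝ}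
  {u v : Rn n → ℝ} {G H : Rn n → Rn n}

theorem HasOrliczGradient.cutoff_interpolation (hΦ : IsYoungFunction Φ) (hU : IsOpen U)
    (hU' : IsOpen U') (hV : IsOpen V) {φ : Rn n → ℝ} (hφ : IsCutoff U' U φ) {Dφ : Rn n → Rn n}
    (hDc : Continuous Dφ) (hD : ∀ x, HasGradientAt φ (Dφ x) x) {L : ℝ} (hL : ∀ x, ‖Dφ x‖ ≤ L)
    (hu : HasOrliczGradient Φ U u G) (hv : HasOrliczGradient Φ V v H) :
    HasOrliczGradient Φ (U' ∪ V) (fun x => φ x * u x + (1 - φ x) * v x)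
      (fun x => φ x • G x + u x • Dφ x + ((1 - φ x) • H x + v x • (-Dφ x))) := by
  have hD' : ∀ x, HasGradientAt (fun y => 1 - φ y) (-Dφ x) x := fun x => by
    rw [hasGradientAt_iff_hasFDerivAt, map_neg]
    exact (hD x).hasFDerivAt.const_sub 1
  refine (hu.mul_cutoff hΦ hU (hU'.union hV) hD hDc hL (fun x => (hφ.2.2.2.1 x).1)
    (fun x => (hφ.2.2.2.1 x).2) fun x _ => ?_).add hΦ (hU'.union hV)
    (hv.mul_cutoff hΦ hV (hU'.union hV) hD' hDc.neg (L := L) (fun x => by simpa using hL x)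
      (fun x => by linarith [(hφ.2.2.2.1 x).2]) (fun x => by linarith [(hφ.2.2.2.1 x).1])
      fun x hx => ?_)
  · by_cases hx : x ∈ tsupport φ
    · exact .inl (hφ.2.2.1 hx)
    · exact .inr (mem_interior_iff_mem_nhds.2 (notMem_tsupport_iff_eventuallyEq.1 hx))
  · rcases hx with hx | hx
    · refine .inr (mem_interior.2 ⟨U', fun y hy => ?_, hU', hx⟩)
      simp [hφ.2.2.2.2 y hy]
    · exact .inl hx

theorem MemOrlicz.cutoff_interpolation (hΦ : IsYoungFunction Φ) (hΩ : IsOpen Ω)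
    {φ : Rn n → ℝ} (hφ : IsCutoff U' U φ) (hu : MemOrlicz Φ Ω u) (hv : MemOrlicz Φ Ω v) :
    MemOrlicz Φ Ω (fun x => φ x * u x + (1 - φ x) * v x) := by
  have hc : Continuous φ := hφ.1.continuous
  have h01 := hφ.2.2.2.1
  refine MemOrlicz.add hΦ
    (hu.of_dominated hΦ hΩ hΩ zero_le_one (hc.aestronglyMeasurable.mul hu.1)
      (fun x hx h => absurd hx h) fun x _ => ?_)
    (hv.of_dominated hΦ hΩ hΩ zero_le_one
      ((continuous_const.sub hc).aestronglyMeasurable.mul hv.1)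
      (fun x hx h => absurd hx h) fun x _ => ?_)
  · rw [norm_mul, Real.norm_of_nonneg (h01 x).1]
    gcongr
    exact (h01 x).2
  · rw [norm_mul, Real.norm_of_nonneg (by linarith [(h01 x).2])]
    gcongr
    linarith [(h01 x).1]

/-- The two terms containing the gradient of the cut-off combine into (a - b)d; hence only the
difference u - v enters the estimate. -/
theorem norm_cutoff_gradient_le {φ L a b : ℝ} {g h d : Rn n} (h0 : 0 ≤ φ) (h1 : φ ≤ 1)
    (hd : ‖d‖ ≤ L) :
    ‖φ • g + a • d + ((1 - φ) • h + b • (-d))‖ ≤ ‖g‖ + (‖h‖ + L * |a - b|) := by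
  have e : φ • g + a • d + ((1 - φ) • h + b • (-d)) = φ • g + ((1 - φ) • h + (a - b) • d) := by
    rw [sub_smul a b, smul_neg]; abel
  rw [e]
  refine (norm_add_le _ _).trans (add_le_add ?_ ((norm_add_le _ _).trans (add_le_add ?_ ?_)))
  · rw [norm_smul, Real.norm_of_nonneg h0]
    exact mul_le_of_le_one_left (norm_nonneg _) h1
  · rw [norm_smul, Real.norm_of_nonneg (by linarith)]
    exact mul_le_of_le_one_left (norm_nonneg _) (by linarith)
  · rw [norm_smul, Real.norm_eq_abs, mul_comm]
    gcongr

theorem lintegral_integrand_cutoff_le (hΦ : IsYoungFunction Φ) (hc₂ : 0 < c₂)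
    (hf : IsIntegrand c₁ c₂ Φ Ω f) (hU : IsOpen U) (hU' : IsOpen U') (hV : IsOpen V)
    (hUΩ : U ⊆ Ω)
    {K : ℝ} (hK : 0 < K) (hadd : ∀ s t, 0 ≤ s → 0 ≤ t → Φ (s + t) ≤ K * (Φ s + Φ t))
    {L KL : ℝ} (hL0 : 0 ≤ L) (hKL : 0 < KL) (hdil : ∀ t, 0 ≤ t → Φ (L * t) ≤ KL * Φ t)
    {φ : Rn n → ℝ} (hφ : IsCutoff U' U φ) {Dφ : Rn n → Rn n}
    (hD : ∀ x, HasGradientAt φ (Dφ x) x) (hL : ∀ x, ‖Dφ x‖ ≤ L)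
    (hG : AEStronglyMeasurable G (volume.restrict U))
    (hH : AEStronglyMeasurable H (volume.restrict V)) :
    ∫⁻ x in U' ∪ V, ENNReal.ofReal
        (f x (φ x • G x + u x • Dφ x + ((1 - φ x) • H x + v x • (-Dφ x)))) ≤
      (∫⁻ x in U, ENNReal.ofReal (f x (G x))) + (∫⁻ x in V, ENNReal.ofReal (f x (H x)))
        + ENNReal.ofReal (c₂ * (1 + K + K * K)) *
          (∫⁻ x in {x | x ∈ U ∩ V ∧ 0 < φ x ∧ φ x < 1},
            (1 + ENNReal.ofReal (Φ ‖G x‖) + ENNReal.ofReal (Φ ‖H x‖)))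
        + ENNReal.ofReal (c₂ * (K * K * KL)) *
          ∫⁻ x in (U ∩ V) \ U', ENNReal.ofReal (Φ |u x - v x|) := by
  obtain ⟨hsm, -, hts, h01, hone⟩ := hφ
  have hc : Continuous φ := hsm.continuous
  set P : Rn n → Rn n := fun x =>
    φ x • G x + u x • Dφ x + ((1 - φ x) • H x + v x • (-Dφ x)) with hP
  have hφU : ∀ x, φ x ≠ 0 → x ∈ U := fun x hx => hts (subset_tsupport _ hx)
  -- At points where φ is 1 or 0 it has an extremum, so its gradient vanishes there.
  have hP1 : ∀ x, φ x = 1 → P x = G x := fun x hx => by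
    have := eq_zero_of_hasGradientAt_of_isLocalMin (f := fun y => 1 - φ y) (f' := -Dφ x) (x := x)
      (by rw [hasGradientAt_iff_hasFDerivAt, map_neg]
          exact (hD x).hasFDerivAt.const_sub 1)
      (.of_forall fun y => by simpa [hx] using (h01 y).2)
    simp [hP, hx, neg_eq_zero.1 this]
  have hP0 : ∀ x, φ x = 0 → P x = H x := fun x hx => by
    have := eq_zero_of_hasGradientAt_of_isLocalMin (hD x)
      (.of_forall fun y => hx ▸ (h01 y).1)
    simp [hP, hx, this]
  set S : Set (Rn n) := {x | x ∈ U ∩ V ∧ 0 < φ x ∧ φ x < 1} with hS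
  have hSm : MeasurableSet S := (hU.inter hV).measurableSet.inter
    ((isOpen_lt continuous_const hc).inter (isOpen_lt hc continuous_const)).measurableSet
  have hSU : S ⊆ (U ∩ V) \ U' := fun x hx => ⟨hx.1, fun hx' => hx.2.2.ne (hone x hx')⟩
  have hcover : U' ∪ V ⊆ ((U' ∪ V) ∩ {x | φ x = 1}) ∪ ((U' ∪ V) ∩ {x | φ x = 0}) ∪ S := by
    intro x hx
    rcases (h01 x).1.eq_or_lt with h0 | h0
    · exact .inl (.inr ⟨hx, h0.symm⟩)
    rcases (h01 x).2.eq_or_lt with h1 | h1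
    · exact .inl (.inl ⟨hx, h1⟩)
    · exact .inr ⟨⟨hφU x h0.ne', hx.resolve_left fun h => h1.ne (hone x h)⟩, h0, h1⟩
  have hW := (hU'.union hV).measurableSet
  have hB1 : ∫⁻ x in (U' ∪ V) ∩ {x | φ x = 1}, ENNReal.ofReal (f x (P x))
      ≤ ∫⁻ x in U, ENNReal.ofReal (f x (G x)) :=
    setLIntegral_le_of_eq_zero_off hU.measurableSet
      (hW.inter (isClosed_eq hc continuous_const).measurableSet)
      (fun x hx hxU => absurd (hφU x (by rw [show φ x = 1 from hx.2]; simp)) hxU)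
      fun x hx _ => by rw [hP1 x hx.2]
  have hB0 : ∫⁻ x in (U' ∪ V) ∩ {x | φ x = 0}, ENNReal.ofReal (f x (P x))
      ≤ ∫⁻ x in V, ENNReal.ofReal (f x (H x)) :=
    setLIntegral_le_of_eq_zero_off hV.measurableSet
      (hW.inter (isClosed_eq hc continuous_const).measurableSet)
      (fun x hx hxV => by
        have h1 := hone x (hx.1.resolve_right hxV)
        rw [show φ x = 0 from hx.2] at h1
        norm_num at h1)
      fun x hx _ => by rw [hP0 x hx.2]
  have hΦ0 : ∀ {t}, 0 ≤ t → 0 ≤ Φ t := hΦ.nonneg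
  -- Splitting the sum of three norms by `hadd` twice gives coefficients c₂, c₂K, c₂K² for 1,
  -- Φ(|G|), Φ(|H|); their sum serves as a common constant, free of `L`.
  have hpt : ∀ x ∈ S, ENNReal.ofReal (f x (P x)) ≤
      ENNReal.ofReal (c₂ * (1 + K + K * K)) *
          (1 + ENNReal.ofReal (Φ ‖G x‖) + ENNReal.ofReal (Φ ‖H x‖))
        + ENNReal.ofReal (c₂ * (K * K * KL)) * ENNReal.ofReal (Φ |u x - v x|) := by
    intro x hx
    have a1 := hf.upper x (hUΩ hx.1.1) (P x)
    have a2 := hΦ.mono (norm_nonneg _) (norm_cutoff_gradient_le (g := G x) (h := H x) (a := u x)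
      (b := v x) (h01 x).1 (h01 x).2 (hL x))
    have a3 := hadd ‖G x‖ (‖H x‖ + L * |u x - v x|) (by positivity) (by positivity)
    have a4 := hadd ‖H x‖ (L * |u x - v x|) (by positivity) (by positivity)
    have a5 := hdil |u x - v x| (abs_nonneg _)
    have g0 := hΦ0 (norm_nonneg (G x))
    have h0 := hΦ0 (norm_nonneg (H x))
    have d0 := hΦ0 (abs_nonneg (u x - v x))
    rw [← ENNReal.ofReal_one, ← ENNReal.ofReal_add zero_le_one g0,
      ← ENNReal.ofReal_add (by positivity) h0, ← ENNReal.ofReal_mul (by positivity),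
      ← ENNReal.ofReal_mul (by positivity),
      ← ENNReal.ofReal_add (by positivity) (by positivity)]
    refine ENNReal.ofReal_le_ofReal ?_
    have a6 : Φ ‖P x‖ ≤ K * Φ ‖G x‖ + K * K * Φ ‖H x‖ + K * K * KL * Φ |u x - v x| := by
      have b1 := mul_le_mul_of_nonneg_left a5 (mul_pos hK hK).le
      have b2 := mul_le_mul_of_nonneg_left a4 hK.le
      simp only [hP]
      nlinarith
    refine a1.trans ?_
    have a7 : c₂ * (1 + Φ ‖P x‖) ≤
        c₂ * (1 + (K * Φ ‖G x‖ + K * K * Φ ‖H x‖ + K * K * KL * Φ |u x - v x|)) := by gcongr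
    refine a7.trans ?_
    have p1 : 0 ≤ c₂ * ((K + K * K) + (1 + K * K) * Φ ‖G x‖ + (1 + K) * Φ ‖H x‖) := by positivity
    linarith
  have hgm : AEMeasurable (fun x => ENNReal.ofReal (c₂ * (1 + K + K * K)) *
      (1 + ENNReal.ofReal (Φ ‖G x‖) + ENNReal.ofReal (Φ ‖H x‖))) (volume.restrict S) := by
    have m1 := hΦ.aemeasurable_comp_norm
      (hG.mono_set (fun x hx => hx.1.1 : S ⊆ U))
    have m2 := hΦ.aemeasurable_comp_norm
      (hH.mono_set (fun x hx => hx.1.2 : S ⊆ V))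
    exact ((aemeasurable_const.add m1).add m2).const_mul _
  have hBS : ∫⁻ x in S, ENNReal.ofReal (f x (P x)) ≤
      ENNReal.ofReal (c₂ * (1 + K + K * K)) *
          (∫⁻ x in S, (1 + ENNReal.ofReal (Φ ‖G x‖) + ENNReal.ofReal (Φ ‖H x‖)))
        + ENNReal.ofReal (c₂ * (K * K * KL)) *
          ∫⁻ x in (U ∩ V) \ U', ENNReal.ofReal (Φ |u x - v x|) := by
    refine (setLIntegral_mono' hSm hpt).trans ?_
    rw [lintegral_add_left' hgm, lintegral_const_mul' _ _ ENNReal.ofReal_ne_top,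
      lintegral_const_mul' _ _ ENNReal.ofReal_ne_top]
    gcongr
  calc ∫⁻ x in U' ∪ V, ENNReal.ofReal (f x (P x))
      ≤ _ := lintegral_mono_set hcover
    _ ≤ _ := (lintegral_union_le _ _ _).trans (add_le_add_left (lintegral_union_le _ _ _) _)
    _ ≤ _ := add_le_add (add_le_add hB1 hB0) hBS
    _ = _ := by rw [← add_assoc]

theorem ofReal_mul_modular_le (hc₁ : 0 < c₁) (hf : IsIntegrand c₁ c₂ Φ Ω f) (hU : IsOpen U)
    (hUΩ : U ⊆ Ω) :
    ENNReal.ofReal c₁ * modular Φ U G ≤ ∫⁻ x in U, ENNReal.ofReal (f x (G x)) := by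
  rw [modular, ← lintegral_const_mul' _ _ ENNReal.ofReal_ne_top]
  refine setLIntegral_mono' hU.measurableSet fun x hx => ?_
  rw [← ENNReal.ofReal_mul hc₁.le]
  exact ENNReal.ofReal_le_ofReal (hf.lower x (hUΩ hx) _)

theorem exists_mul_setLIntegral_le {α : Type*} [MeasurableSpace α] {μ : Measure α} {N : ℕ}
    (hN : 0 < N) {S : ℕ → Set α} {D : Set α} (hS : ∀ i < N, MeasurableSet (S i))
    (hSD : ∀ i < N, S i ⊆ D) (hd : ∀ i < N, ∀ j < N, i ≠ j → Disjoint (S i) (S j))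
    (g : α → ℝ≥0∞) : ∃ i < N, (N : ℝ≥0∞) * ∫⁻ x in S i, g x ∂μ ≤ ∫⁻ x in D, g x ∂μ := by
  obtain ⟨i, hi, hmin⟩ := (Finset.range N).exists_min_image (fun i => ∫⁻ x in S i, g x ∂μ)
    ⟨0, Finset.mem_range.2 hN⟩
  refine ⟨i, Finset.mem_range.1 hi, ?_⟩
  have h1 := Finset.card_nsmul_le_sum (Finset.range N) (fun i => ∫⁻ x in S i, g x ∂μ) _ hmin
  rw [Finset.card_range, nsmul_eq_mul] at h1
  refine h1.trans ?_
  rw [← lintegral_biUnion_finset]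
  · exact lintegral_mono_set (iUnion₂_subset fun j hj => hSD j (Finset.mem_range.1 hj))
  · intro i hi j hj hij
    exact hd i (by simpa using hi) j (by simpa using hj) hij
  · exact fun j hj => hS j (Finset.mem_range.1 hj)

/-- The absorption step: E is the layer integral, m the volume of D, X and Y the modulars of the
gradients, a and b the energies. After multiplication by A, the factor N cancels. -/
theorem ofReal_mul_le_of_natCast_mul_le {N : ℕ} (hN : 0 < N) {A σ c : ℝ} (hσ : 0 < σ)
    {m E X Y a b : ℝ≥0∞} (hE : N * E ≤ m + X + Y) (hX : ENNReal.ofReal c * X ≤ a)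
    (hY : ENNReal.ofReal c * Y ≤ b) (hm : ENNReal.ofReal A * m ≤ ENNReal.ofReal (N * σ))
    (hA : A ≤ N * σ * c) :
    ENNReal.ofReal A * E ≤ ENNReal.ofReal σ * (a + b) + ENNReal.ofReal σ := by
  have hN0 : (N : ℝ≥0∞) ≠ 0 := by exact_mod_cast hN.ne'
  have hNσ : ENNReal.ofReal (N * σ) = N * ENNReal.ofReal σ := by
    rw [ENNReal.ofReal_mul (by positivity), ENNReal.ofReal_natCast]
  have hAX : ∀ {Z d : ℝ≥0∞}, ENNReal.ofReal c * Z ≤ d →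
      ENNReal.ofReal A * Z ≤ N * ENNReal.ofReal σ * d := fun {Z d} hZ => by
    calc ENNReal.ofReal A * Z ≤ ENNReal.ofReal (N * σ * c) * Z := by gcongr
      _ = N * ENNReal.ofReal σ * (ENNReal.ofReal c * Z) := by
        rw [ENNReal.ofReal_mul (by positivity), hNσ, mul_assoc]
      _ ≤ _ := by gcongr
  refine (ENNReal.mul_le_mul_iff_right hN0 (ENNReal.natCast_ne_top N)).1 ?_
  calc (N : ℝ≥0∞) * (ENNReal.ofReal A * E) = ENNReal.ofReal A * (N * E) := by ring
    _ ≤ ENNReal.ofReal A * (m + X + Y) := by gcongr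
    _ = ENNReal.ofReal A * m + ENNReal.ofReal A * X + ENNReal.ofReal A * Y := by ring
    _ ≤ N * ENNReal.ofReal σ + N * ENNReal.ofReal σ * a + N * ENNReal.ofReal σ * b := by
        exact add_le_add (add_le_add (hm.trans_eq hNσ) (hAX hX)) (hAX hY)
    _ = _ := by ring

theorem uniformFundamentalEstimate_functionalClass (hΩ : IsOpen Ω) (hΦ : IsYoungFunction Φ)
    (hc₁ : 0 < c₁) (hc₂ : 0 < c₂) :
    UniformFundamentalEstimate Φ Ω (functionalClass c₁ c₂ Φ Ω) := by
  intro U U' V hU hU' hV hUΩ hU'Ω hVΩ hcc σ hσ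
  obtain ⟨K, hK, hadd⟩ := hΦ.exists_add_le
  obtain ⟨D, hDc, hfam⟩ := exists_cutoff_family hU hcc
  set A : ℝ := c₂ * (1 + K + K * K) with hA
  -- The first bound absorbs the volume of `D` into the additive σ, the second the modulars into σ
  -- times the energies.
  obtain ⟨N, hN⟩ := exists_nat_gt (max (A * (volume D).toReal / σ) (A / (σ * c₁)))
  have hN1 : A * (volume D).toReal ≤ N * σ := by
    have := (le_max_left _ _).trans hN.le
    rwa [div_le_iff₀ hσ] at this
  have hN2 : A ≤ N * σ * c₁ := by
    have := (le_max_right _ _).trans hN.le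
    rwa [div_le_iff₀ (by positivity), ← mul_assoc] at this
  have hN0 : 0 < N := by
    have h0 : 0 ≤ A / (σ * c₁) := by positivity
    exact_mod_cast h0.trans_lt ((le_max_right _ _).trans_lt hN)
  obtain ⟨φ, hφ, hφD, hφd⟩ := hfam N
  have hex : ∀ i, ∃ Dφ : Rn n → Rn n, ∃ L : ℝ, i < N → Continuous Dφ ∧
      (∀ x, HasGradientAt (φ i) (Dφ x) x) ∧ ∀ x, ‖Dφ x‖ ≤ L := fun i => by
    by_cases hi : i < N
    · obtain ⟨Dφ, h1, h2, L, h3⟩ := (hφ i hi).exists_gradient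
      exact ⟨Dφ, L, fun _ => ⟨h1, h2, h3⟩⟩
    · exact ⟨0, 0, fun h => absurd h hi⟩
  choose Dφ Lf hDφ using hex
  -- One gradient bound for the whole family, fixed before `F`, `u`, `v` appear, keeps M independent
  -- of the index selected later.
  obtain ⟨L, hL⟩ := ((Finset.range N).image Lf).exists_le
  have hLi : ∀ i < N, ∀ x, ‖Dφ i x‖ ≤ L := fun i hi x =>
    ((hDφ i hi).2.2 x).trans (hL _ (Finset.mem_image_of_mem _ (Finset.mem_range.2 hi)))
  have hL0 : 0 ≤ L := (norm_nonneg _).trans (hLi 0 hN0 0)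
  obtain ⟨KL, hKL, hdil⟩ := hΦ.exists_dilation hL0
  refine ⟨c₂ * (K * K * KL), by positivity, fun F hF u v hu hv => ?_⟩
  obtain ⟨f, hf, hFf⟩ := hF
  have htriv : F u U = ∞ ∨ F v V = ∞ → ∃ ψ : Rn n → ℝ, IsCutoff U' U ψ ∧
      F (fun x => ψ x * u x + (1 - ψ x) * v x) (U' ∪ V) ≤
        ENNReal.ofReal (1 + σ) * (F u U + F v V)
          + ENNReal.ofReal (c₂ * (K * K * KL)) *
            (∫⁻ x in (U ∩ V) \ U', ENNReal.ofReal (Φ |u x - v x|))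
          + ENNReal.ofReal σ := by
    intro h
    refine ⟨φ 0, hφ 0 hN0, ?_⟩
    have h1 : F u U + F v V = ∞ := ENNReal.add_eq_top.2 h
    have h2 : ENNReal.ofReal (1 + σ) ≠ 0 := (ENNReal.ofReal_pos.2 (by positivity)).ne'
    rw [h1, ENNReal.mul_top h2, top_add, top_add]
    exact le_top
  by_cases hus : MemOrliczSobolev Φ U u
  swap
  · exact htriv (.inl ((hFf U hU hUΩ u hu).2 hus))
  by_cases hvs : MemOrliczSobolev Φ V v
  swap
  · exact htriv (.inr ((hFf V hV hVΩ v hv).2 hvs))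
  obtain ⟨G, hG⟩ := hus
  obtain ⟨H, hH⟩ := hvs
  have hFu := (hFf U hU hUΩ u hu).1 G hG
  have hFv := (hFf V hV hVΩ v hv).1 H hH
  have hGm : AEMeasurable (fun x => ENNReal.ofReal (Φ ‖G x‖)) (volume.restrict (U ∩ V ∩ D)) :=
    hΦ.aemeasurable_comp_norm (hG.2.1.1.mono_set fun x hx => hx.1.1)
  obtain ⟨i, hi, hpig⟩ := exists_mul_setLIntegral_le (μ := volume) hN0
    (S := fun i => {x | x ∈ U ∩ V ∧ 0 < φ i x ∧ φ i x < 1}) (D := U ∩ V ∩ D)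
    (fun i hi => by
      have hc : Continuous (φ i) := (hφ i hi).1.continuous
      exact (hU.inter hV).measurableSet.inter
        ((isOpen_lt continuous_const hc).inter (isOpen_lt hc continuous_const)).measurableSet)
    (fun i _ x hx => ⟨hx.1, hφD i x hx.2.1⟩)
    (fun i _ j _ hij => Set.disjoint_left.2 fun x hx hx' =>
      hij (hφd i j x hx.2.1 hx.2.2 hx'.2.1 hx'.2.2))
    (fun x => 1 + ENNReal.ofReal (Φ ‖G x‖) + ENNReal.ofReal (Φ ‖H x‖))
  refine ⟨φ i, hφ i hi, ?_⟩
  have hE := hpig.trans (show _ ≤ volume D + modular Φ U G + modular Φ V H by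
    rw [lintegral_add_left' (f := fun x => 1 + ENNReal.ofReal (Φ ‖G x‖))
      (aemeasurable_const.add hGm), lintegral_add_left' aemeasurable_const,
      setLIntegral_one]
    refine add_le_add (add_le_add (measure_mono inter_subset_right) ?_) ?_
    · exact lintegral_mono_set fun x hx => hx.1.1
    · exact lintegral_mono_set fun x hx => hx.1.2)
  have hvol : ENNReal.ofReal A * volume D ≤ ENNReal.ofReal (N * σ) := by
    rw [← ENNReal.ofReal_toReal hDc.measure_lt_top.ne, ← ENNReal.ofReal_mul (by positivity)]
    exact ENNReal.ofReal_le_ofReal hN1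
  have hlayer := ofReal_mul_le_of_natCast_mul_le hN0 hσ hE
    (ofReal_mul_modular_le hc₁ hf hU hUΩ) (ofReal_mul_modular_le hc₁ hf hV hVΩ) hvol hN2
  rw [← hFu, ← hFv] at hlayer
  obtain ⟨hcont, hgrad, -⟩ := hDφ i hi
  -- The functional may be evaluated with any admissible gradient, so exhibiting one for the
  -- interpolation suffices.
  rw [(hFf (U' ∪ V) (hU'.union hV) (union_subset hU'Ω hVΩ) _
    (hu.cutoff_interpolation hΦ hΩ (hφ i hi) hv)).1 _
    (hG.cutoff_interpolation hΦ hU hU' hV (hφ i hi) hcont hgrad (hLi i hi) hH)]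
  refine (lintegral_integrand_cutoff_le hΦ hc₂ hf hU hU' hV hUΩ hK hadd hL0 hKL hdil
    (hφ i hi) hgrad (hLi i hi) hG.2.1.1 hH.2.1.1).trans ?_
  rw [← hFu, ← hFv]
  refine (add_le_add_left (add_le_add_right hlayer _) _).trans (le_of_eq ?_)
  rw [ENNReal.ofReal_add zero_le_one hσ.le, ENNReal.ofReal_one]
  ring

end Estimate

end OrliczFunctionals

theorem proposition7 (n : ℕ) (Ω : Set (OrliczFunctionals.Rn n)) (hΩ : IsOpen Ω)
    (Φ : ℝ → ℝ) (hΦ : OrliczFunctionals.IsYoungFunction Φ)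
    (c₁ c₂ : ℝ) (hc₁ : 0 < c₁) (hc₂ : 0 < c₂) :
    OrliczFunctionals.UniformFundamentalEstimate Φ Ω
      (OrliczFunctionals.functionalClass c₁ c₂ Φ Ω) :=
  OrliczFunctionals.uniformFundamentalEstimate_functionalClass hΩ hΦ hc₁ hc₂
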